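/- Let $\delta\ge 0$. For a metric space $X$ and $o,x,y\in X$ write $(x\mid y)_o=\frac12\left(d(x,o)+d(y,o)-d(x,y)\right)$; $X$ is $\delta$-hyperbolic if $(x\mid z)_o\ge\min\{(x\mid y)_o,(y\mid z)_o\}-\delta$ for all $o,x,y,z\in X$. If $X$ is $\delta$-hyperbolic, its boundary $\partial_\infty X$ is the set of sequences $(x_n)$ in $X$ with $(x_n\mid x_m)_o\to+\infty$ as $n,m\to+\infty$, modulo the relation $(x_n\mid y_n)_o\to+\infty$. For $\xi,\eta\in\partial_\infty X$ put $(\xi\mid\eta)_o=\inf\liminf_n (x_n\mid y_n)_o\in[0,+\infty]$, the infimum being over all sequences $(x_n)$ representing $\xi$ and $(y_n)$ representing $\eta$. Let $\mu(\delta)=2^{1/\delta}$ if $\delta>0$ and $\mu(0)=e$. For $\nu\in(1,\mu(\delta)]$ let $d_\nu$ be the visual distance $$d_\nu(\xi,\eta)=\inf\left\{\sum_{i=1}^n \nu^{-(c_{i-1}\mid c_i)_o} : n\ge 1,\ c_0,\dots,c_n\in\partial_\infty X,\ c_0=\xi,\ c_n=\eta\right\}\qquad(\nu^{-\infty}=0),$$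 and for distinct $\xi_1,\dots,\xi_4\in\partial_\infty X$ let $$[\xi_1,\xi_2,\xi_3,\xi_4]^{d_\nu}=\frac{d_\nu(\xi_1,\xi_3)\,d_\nu(\xi_2,\xi_4)}{d_\nu(\xi_1,\xi_4)\,d_\nu(\xi_2,\xi_3)},\qquad \log_\nu^+ s=\max\{0,\log_\nu s\}.$$ **Proposition.** For every $\delta\ge0$ there is a constant $C=C(\delta)\ge0$ such that for every proper geodesic $\delta$-hyperbolic metric space $X$, every base point $o\in X$, every $\nu\in(1,\mu(\delta)]$ (in particular $\nu=\mu(\delta)$) and all pairwise distinct $\xi_1,\xi_2,\xi_3,\xi_4\in\partial_\infty X$, the following holds. There exist geodesic lines (isometric embeddings $\mathbb R\to X$) with endpoints $\xi_1,\xi_4$ and with endpoints $\xi_2,\xi_3$, and for any geodesic line $\chi_{14}$ between $\xi_1$ and $\xi_4$ and any geodesic line $\chi_{23}$ between $\xi_2$ and $\xi_3$, $$d_X(\chi_{14},\chi_{23})-C\ \le\ \log_\nu^+[\xi_1,\xi_2,\xi_3,\xi_4]^{d_\nu}\ \le\ d_X(\chi_{14},\chi_{23})+C,$$ where $d_X(\chi_{14},\chi_{23})=\inf_{s,t\in\mathbb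 R} d_X(\chi_{14}(s),\chi_{23}(t))$. -/

import Mathlib

open Filter Topology

universe u

namespace GromovHyp

/-- The Gromov product `(x | y)_o = (|x - o| + |y - o| - |x - y|) / 2`. -/
noncomputable def gromovProduct {X : Type u} [MetricSpace X] (o x y : X) : ℝ :=
  (dist x o + dist y o - dist x y) / 2

/-- `X` is `δ`-hyperbolic in the sense of Gromov (four-point condition, for all base points). -/
def IsHyperbolic (X : Type u) [MetricSpace X] (δ : ℝ) : Prop :=
  ∀ o x y z : X,
    min (gromovProduct o x y) (gromovProduct o y z) - δ ≤ gromovProduct o x z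

/-- `X` is geodesic: any two points are the endpoints of an isometrically embedded segment. -/
def IsGeodesicSpace (X : Type u) [MetricSpace X] : Prop :=
  ∀ x y : X, ∃ γ : ℝ → X, γ 0 = x ∧ γ (dist x y) = y ∧
    ∀ s ∈ Set.Icc (0 : ℝ) (dist x y), ∀ t ∈ Set.Icc (0 : ℝ) (dist x y),
      dist (γ s) (γ t) = |s - t|

/-- `x` is a Cauchy-Gromov sequence: `(x_n | x_m)_o → +∞` as `n, m → +∞`. -/
def IsCauchyGromov {X : Type u} [MetricSpace X] (o : X) (x : ℕ → X) : Prop :=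
  Tendsto (fun p : ℕ × ℕ => gromovProduct o (x p.1) (x p.2)) (atTop ×ˢ atTop) atTop

/-- The type of Cauchy-Gromov sequences. -/
def CGSeq {X : Type u} [MetricSpace X] (o : X) : Type u :=
  {x : ℕ → X // IsCauchyGromov o x}

/-- Equivalence of Cauchy-Gromov sequences: `(x_n | y_n)_o → +∞`. -/
def CGSeq.Equivalent {X : Type u} [MetricSpace X] {o : X} (x y : CGSeq o) : Prop :=
  Tendsto (fun n : ℕ => gromovProduct o (x.1 n) (y.1 n)) atTop atTop

theorem CGSeq.equivalent_equivalence {X : Type u} [MetricSpace X] {δ : ℝ}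
    (hX : IsHyperbolic X δ) (o : X) :
    Equivalence (CGSeq.Equivalent : CGSeq o → CGSeq o → Prop) where
  refl x := by
    have h : Tendsto (fun n : ℕ => (n, n)) atTop (atTop ×ˢ atTop : Filter (ℕ × ℕ)) :=
      tendsto_id.prodMk tendsto_id
    exact Tendsto.comp x.2 h
  symm {x y} h := by
    have e : (fun n : ℕ => gromovProduct o (y.1 n) (x.1 n)) =
        fun n : ℕ => gromovProduct o (x.1 n) (y.1 n) := by
      funext n
      simp only [gromovProduct, dist_comm (y.1 n) (x.1 n)]
      ring
    unfold CGSeq.Equivalent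
    rw [e]
    exact h
  trans {x y z} h₁ h₂ := by
    unfold CGSeq.Equivalent at *
    rw [tendsto_atTop] at *
    intro b
    filter_upwards [h₁ (b + δ), h₂ (b + δ)] with n a₁ a₂
    have h := hX o (x.1 n) (y.1 n) (z.1 n)
    have h' := le_min a₁ a₂
    linarith

/-- Equivalence of Cauchy-Gromov sequences, as a setoid. -/
def boundarySetoid {X : Type u} [MetricSpace X] {δ : ℝ} (hX : IsHyperbolic X δ) (o : X) :
    Setoid (CGSeq o) where
  r := CGSeq.Equivalent
  iseqv := CGSeq.equivalent_equivalence hX o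

/-- The Gromov boundary of a hyperbolic space: Cauchy-Gromov sequences up to equivalence.
For a proper geodesic space it is the geodesic boundary `∂_∞ X`. -/
def Boundary {X : Type u} [MetricSpace X] {δ : ℝ} (hX : IsHyperbolic X δ) (o : X) : Type u :=
  Quotient (boundarySetoid hX o)

section

variable {X : Type u} [MetricSpace X] {δ : ℝ} {hX : IsHyperbolic X δ} {o : X}

/-- The sequence `x` converges to the boundary point `ξ`: it is Cauchy-Gromov and its class
is `ξ`. -/
def ConvergesTo (x : ℕ → X) (ξ : Boundary hX o) : Prop :=
  ∃ h : IsCauchyGromov o x, Quotient.mk (boundarySetoid hX o) ⟨x, h⟩ = ξ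

/-- `χ` is a geodesic line from `ξ` (at `-∞`) to `η` (at `+∞`). -/
def IsLineBetween (χ : ℝ → X) (ξ η : Boundary hX o) : Prop :=
  Isometry χ ∧ ConvergesTo (fun n : ℕ => χ (-(n : ℝ))) ξ ∧ ConvergesTo (fun n : ℕ => χ n) η

/-- The Gromov product of boundary points, `(ξ | η)_o = inf liminf (x_n | y_n)_o` over all
sequences `x_n → ξ`, `y_n → η`; it is `+∞` for `ξ = η`. -/
noncomputable def boundaryProduct (ξ η : Boundary hX o) : EReal :=
  ⨅ (x : ℕ → X) (y : ℕ → X) (_ : ConvergesTo x ξ) (_ : ConvergesTo y η),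
    liminf (fun n : ℕ => ((gromovProduct o (x n) (y n) : ℝ) : EReal)) atTop

open Classical in
/-- The visual quasimetric `ρ_ν(ξ, η) = ν ^ (-(ξ | η)_o)`, with `ν ^ (-∞) = 0`. -/
noncomputable def visualKernel (ν : ℝ) (ξ η : Boundary hX o) : ℝ :=
  if boundaryProduct ξ η = ⊤ then 0 else ν ^ (-(boundaryProduct ξ η).toReal)

/-- The visual distance `d_ν`, obtained from `ρ_ν` by the chain construction: the infimum of
`∑ i, ρ_ν(c_{i-1}, c_i)` over all finite chains `ξ = c_0, …, c_n = η` with `n ≥ 1`. -/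
noncomputable def visualDist (ν : ℝ) (ξ η : Boundary hX o) : ℝ :=
  sInf {s : ℝ | ∃ (n : ℕ) (c : ℕ → Boundary hX o), 1 ≤ n ∧ c 0 = ξ ∧ c n = η ∧
    s = ∑ i ∈ Finset.range n, visualKernel ν (c i) (c (i + 1))}

/-- The cross-ratio `d(ξ₁, ξ₃) d(ξ₂, ξ₄) / (d(ξ₁, ξ₄) d(ξ₂, ξ₃))` for `d = d_ν`. -/
noncomputable def crossRatio (ν : ℝ) (ξ₁ ξ₂ ξ₃ ξ₄ : Boundary hX o) : ℝ :=
  (visualDist ν ξ₁ ξ₃ * visualDist ν ξ₂ ξ₄) / (visualDist ν ξ₁ ξ₄ * visualDist ν ξ₂ ξ₃)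

end

/-- The largest visual parameter `μ(δ)`: `2 ^ (1 / δ)` if `δ > 0`, and `e` if `δ = 0`. -/
noncomputable def visualParam (δ : ℝ) : ℝ :=
  if 0 < δ then (2 : ℝ) ^ (1 / δ) else Real.exp 1

/-- The positive part of the logarithm in base `ν`. -/
noncomputable def posLogb (ν s : ℝ) : ℝ := max 0 (Real.logb ν s)

/-- The distance between two nonempty subsets, `inf {|a - b| : a ∈ A, b ∈ B}`. -/
noncomputable def setDist {X : Type u} [MetricSpace X] (A B : Set X) : ℝ :=
  ⨅ p : A × B, dist (p.1 : X) (p.2 : X)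

end GromovHyp

/-! Put E = (ξ₁|ξ₄) + (ξ₂|ξ₃) - (ξ₁|ξ₃) - (ξ₂|ξ₄). Both the positive logarithm of the cross-ratio
and the distance between the lines equal max(0, E) up to an error depending only on δ. For the
cross-ratio, Frink's chain argument shows that d_ν is ν^(-(·|·)) up to a bounded change of the
exponent, uniformly in ν (`visualKernel_le_sum`, `abs_logb_crossRatio_sub_le`). For the lines, take
the finite analogue of E at the points with parameters ±n, where the base point cancels. The
triangle inequality bounds it above by the distance between any two points of the lines with
parameters in [-n, n] (`gromovProduct_sub_le_dist`); conversely, hyperbolicity yields two points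
whose distance is at most its positive part plus 5δ (`exists_dist_geodesics_le`). Products along
sequences stay boundedly close to boundary products, so both estimates pass to the boundary
(`setDist_range_bounds`). The lines themselves are limits of geodesic segments that pass within a
bounded distance of `o`. -/

namespace GromovHyp

/-! ### Gromov products and pairs of geodesics at finite distance -/

section Finite

variable {X : Type u} [MetricSpace X] {δ : ℝ}

theorem gromovProduct_comm (o x y : X) : gromovProduct o x y = gromovProduct o y x := by
  simp only [gromovProduct, dist_comm x y]; ring

theorem gromovProduct_nonneg (o x y : X) : 0 ≤ gromovProduct o x y := by
  have := dist_triangle_right x y o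
  unfold gromovProduct; linarith

theorem gromovProduct_le_dist_left (o x y : X) : gromovProduct o x y ≤ dist x o := by
  have := dist_triangle_left y o x
  unfold gromovProduct; linarith

/-- The four-point condition for the three sums of opposite distances. -/
theorem IsHyperbolic.four_point (hX : IsHyperbolic X δ) (x y z w : X) :
    dist x z + dist y w ≤ max (dist x y + dist z w) (dist x w + dist y z) + 2 * δ := by
  have h := hX w x y z
  simp only [gromovProduct] at h
  rcases min_le_iff.1 (sub_le_iff_le_add.1 h) with h | h
  · have := le_max_left (dist x y + dist z w) (dist x w + dist y z); linarith
  · have := le_max_right (dist x y + dist z w) (dist x w + dist y z); linarith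

/-- A point at distance `(p | y)_x` from `x` on a geodesic `[x, y]` is at distance at most
`(x | y)_p + 2δ` from `p`. -/
theorem IsHyperbolic.dist_le_of_internal_point (hX : IsHyperbolic X δ) {p q x y : X}
    (hx : dist x q = gromovProduct x p y) (hy : dist q y = dist x y - gromovProduct x p y) :
    dist p q ≤ gromovProduct p x y + 2 * δ := by
  -- This choice of `q` makes the two sums in the maximum equal.
  have h := hX.four_point p x q y
  simp only [gromovProduct, dist_comm p x, dist_comm y x, dist_comm y p] at *
  rcases max_cases (dist x p + dist q y) (dist p y + dist x q) with ⟨e, _⟩ | ⟨e, _⟩ <;>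
    rw [e] at h <;> linarith

/-- A geodesic `[x, y]` has a point at distance `(p | y)_x` from `x`. -/
theorem exists_internal_point {γ : ℝ → X} {a b : ℝ}
    (hab : a ≤ b)
    (hγ : ∀ s ∈ Set.Icc a b, ∀ t ∈ Set.Icc a b, dist (γ s) (γ t) = |s - t|) (p : X) :
    ∃ t ∈ Set.Icc a b, dist (γ a) (γ t) = gromovProduct (γ a) p (γ b) ∧
      dist (γ t) (γ b) = dist (γ a) (γ b) - gromovProduct (γ a) p (γ b) := by
  have hd : dist (γ a) (γ b) = b - a := by
    rw [hγ a ⟨le_rfl, hab⟩ b ⟨hab, le_rfl⟩, abs_sub_comm, abs_of_nonneg (by linarith)]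
  have h0 := gromovProduct_nonneg (γ a) p (γ b)
  have h1 := gromovProduct_le_dist_left (γ a) (γ b) p
  rw [gromovProduct_comm, dist_comm] at h1
  set g := gromovProduct (γ a) p (γ b)
  have ht : a + g ∈ Set.Icc a b := ⟨by linarith, by linarith⟩
  refine ⟨a + g, ht, ?_, ?_⟩
  · rw [hγ a ⟨le_rfl, hab⟩ _ ht, abs_sub_comm, abs_of_nonneg (by linarith)]; ring
  · rw [hγ _ ht b ⟨hab, le_rfl⟩, abs_sub_comm, abs_of_nonneg (by linarith), hd]; ring

/-- Two geodesics `[x₁, x₄]` and `[x₂, x₃]` are at distance at most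
`max 0 ((x₁ | x₄) + (x₂ | x₃) - (x₁ | x₃) - (x₂ | x₄)) + 5δ`. -/
theorem IsHyperbolic.exists_dist_geodesics_le (hX : IsHyperbolic X δ) {γ σ : ℝ → X}
    {a b c d : ℝ} (hab : a ≤ b) (hcd : c ≤ d)
    (hγ : ∀ s ∈ Set.Icc a b, ∀ t ∈ Set.Icc a b, dist (γ s) (γ t) = |s - t|)
    (hσ : ∀ s ∈ Set.Icc c d, ∀ t ∈ Set.Icc c d, dist (σ s) (σ t) = |s - t|) (o : X) :
    ∃ s t, dist (γ s) (σ t) ≤ max 0 (gromovProduct o (γ a) (γ b) + gromovProduct o (σ c) (σ d)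
      - gromovProduct o (γ a) (σ d) - gromovProduct o (σ c) (γ b)) + 5 * δ := by
  obtain ⟨s, -, hs1, hs2⟩ := exists_internal_point hab hγ (σ c)
  obtain ⟨t, -, ht1, ht2⟩ := exists_internal_point hcd hσ (γ s)
  refine ⟨s, t, ?_⟩
  have hp := hX.dist_le_of_internal_point hs1 hs2
  have hq := hX.dist_le_of_internal_point ht1 ht2
  -- `hq` reduces the claim to bounding d(p, x₂), done by `hp`, and d(p, x₃), done by `h3`. The
  -- first alternative of `h3` produces the pairing d(x₁, x₂) + d(x₃, x₄), which `h4` trades for the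
  -- other two pairings at the cost of the fifth δ.
  have h3 := hX.four_point (γ s) (γ a) (σ d) (γ b)
  have h4 := hX.four_point (γ a) (γ b) (σ c) (σ d)
  generalize γ a = x₁ at *
  generalize γ b = x₄ at *
  generalize σ c = x₂ at *
  generalize σ d = x₃ at *
  generalize γ s = p at *
  simp only [gromovProduct, dist_comm p x₁, dist_comm p x₂, dist_comm x₄ x₂,
    dist_comm x₂ x₁, dist_comm x₃ x₄, dist_comm x₄ x₁, dist_comm x₃ p,
    dist_comm x₃ x₂] at *
  rcases max_cases (dist x₁ p + dist x₄ x₃) (dist p x₄ + dist x₁ x₃) with ⟨e, _⟩ | ⟨e, _⟩ <;>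
    rw [e] at h3
  · rcases max_cases (dist x₁ x₄ + dist x₂ x₃) (dist x₁ x₃ + dist x₂ x₄) with ⟨e, _⟩ | ⟨e, _⟩ <;>
    rw [e] at h4
    · refine le_trans ?_ (add_le_add_left (le_max_left _ _) _)
      linarith
    · refine le_trans ?_ (add_le_add_left (le_max_right _ _) _)
      linarith
  · have hδ : 0 ≤ δ := by
      have := hX p p p p
      rw [min_self] at this; linarith
    refine le_trans ?_ (add_le_add_left (le_max_right _ _) _)
    linarith

/-- The elementary half of the comparison; it holds in every metric space. -/
theorem gromovProduct_sub_le_dist {γ σ : ℝ → X} (hγ : Isometry γ) (hσ : Isometry σ)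
    {s t n : ℝ} (hs : |s| ≤ n) (ht : |t| ≤ n) (o : X) :
    gromovProduct o (γ (-n)) (γ n) + gromovProduct o (σ (-n)) (σ n)
      - gromovProduct o (γ (-n)) (σ n) - gromovProduct o (σ (-n)) (γ n)
      ≤ dist (γ s) (σ t) := by
  obtain ⟨hs1, hs2⟩ := abs_le.1 hs
  obtain ⟨ht1, ht2⟩ := abs_le.1 ht
  have e1 : dist (γ (-n)) (γ n) = 2 * n := by
    rw [hγ.dist_eq, Real.dist_eq, abs_of_nonpos (by linarith)]; ring
  have e2 : dist (σ (-n)) (σ n) = 2 * n := by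
    rw [hσ.dist_eq, Real.dist_eq, abs_of_nonpos (by linarith)]; ring
  have e3 : dist (γ (-n)) (γ s) = s + n := by
    rw [hγ.dist_eq, Real.dist_eq, abs_of_nonpos (by linarith)]; ring
  have e4 : dist (γ s) (γ n) = n - s := by
    rw [hγ.dist_eq, Real.dist_eq, abs_of_nonpos (by linarith)]; ring
  have e5 : dist (σ (-n)) (σ t) = t + n := by
    rw [hσ.dist_eq, Real.dist_eq, abs_of_nonpos (by linarith)]; ring
  have e6 : dist (σ t) (σ n) = n - t := by
    rw [hσ.dist_eq, Real.dist_eq, abs_of_nonpos (by linarith)]; ring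
  -- The two paths cross over between the lines in opposite directions, so `s` and `t` cancel in the
  -- sum of their lengths.
  have t1 := dist_triangle4 (γ (-n)) (γ s) (σ t) (σ n)
  have t2 := dist_triangle4 (σ (-n)) (σ t) (γ s) (γ n)
  rw [dist_comm (σ t) (γ s)] at t2
  simp only [gromovProduct]
  linarith

end Finite

/-! ### Chain inequalities -/

section Chain

/-- Frink's chain inequality with constant `2`: the sum over a chain, with the first and the
last link counted half, controls a quarter of the quasimetric. -/
theorem chain_le_of_le_two_mul_max {α : Type*} {ρ : α → α → ℝ} (h0 : ∀ x y, 0 ≤ ρ x y)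
    (h : ∀ x y z, ρ x z ≤ 2 * max (ρ x y) (ρ y z)) (n : ℕ) :
    ∀ c : ℕ → α, ρ (c 0) (c (n + 2)) ≤
      4 * ∑ i ∈ Finset.range (n + 2), ρ (c i) (c (i + 1))
        - 2 * ρ (c 0) (c 1) - 2 * ρ (c (n + 1)) (c (n + 2)) := by
  induction n using Nat.strong_induction_on with
  | _ n ih =>
    intro c
    have hS : ∑ i ∈ Finset.range (n + 2), ρ (c i) (c (i + 1)) =
        ρ (c 0) (c 1) + ∑ i ∈ Finset.range n, ρ (c (i + 1)) (c (i + 1 + 1))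
          + ρ (c (n + 1)) (c (n + 2)) := by
      rw [Finset.sum_range_succ, Finset.sum_range_succ']; ring
    have hM : 0 ≤ ∑ i ∈ Finset.range n, ρ (c (i + 1)) (c (i + 1 + 1)) :=
      Finset.sum_nonneg fun i _ => h0 _ _
    have hf := h0 (c 0) (c 1)
    have hl := h0 (c (n + 1)) (c (n + 2))
    by_cases h1 : ρ (c 0) (c (n + 2)) ≤ 2 * ρ (c (n + 1)) (c (n + 2))
    · linarith
    have split : ∀ p, ¬ ρ (c 0) (c (n + 2)) ≤ 2 * ρ (c p) (c (n + 2)) →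
        ρ (c 0) (c (n + 2)) ≤ 2 * ρ (c 0) (c p) := by
      intro p hp
      have := h (c 0) (c p) (c (n + 2))
      rcases max_cases (ρ (c 0) (c p)) (ρ (c p) (c (n + 2))) with ⟨e, _⟩ | ⟨e, _⟩ <;>
        rw [e] at this
      · exact this
      · exact absurd this hp
    -- At such a `p`, the chains from `c 0` to `c (p + 2)` and from `c (p + 1)` to the end overlap
    -- in one link. It is the last link of one and the first of the other, so its two half-weights
    -- add up to a full one.
    by_cases h2 : ∃ p, p < n ∧ ρ (c 0) (c (n + 2)) ≤ 2 * ρ (c (p + 1)) (c (n + 2)) ∧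
        ¬ ρ (c 0) (c (n + 2)) ≤ 2 * ρ (c (p + 2)) (c (n + 2))
    · obtain ⟨p, hpn, hp1, hp2⟩ := h2
      have hp3 := split _ hp2
      obtain ⟨q, rfl⟩ : ∃ q, n = p + 1 + q := ⟨n - (p + 1), by omega⟩
      have i1 := ih p hpn c
      have i2 := ih q (by omega) (fun i => c (p + 1 + i))
      have e : ∑ i ∈ Finset.range (p + 1 + q + 2), ρ (c i) (c (i + 1)) =
          ∑ i ∈ Finset.range (p + 1), ρ (c i) (c (i + 1)) +
          ∑ i ∈ Finset.range (q + 2), ρ (c (p + 1 + i)) (c (p + 1 + i + 1)) := by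
        rw [← Finset.sum_range_add (fun i => ρ (c i) (c (i + 1))), add_assoc (p + 1)]
      rw [e]
      rw [Finset.sum_range_succ] at i1
      simp only [← add_assoc, add_zero] at i1 i2 ⊢
      linarith
    -- Without a switch, the failure at the last link propagates back to `c 1`, so the first link
    -- alone controls the total.
    · push Not at h2
      have hno : ∀ p, p ≤ n → ¬ ρ (c 0) (c (n + 2)) ≤ 2 * ρ (c (p + 1)) (c (n + 2)) := by
        intro p hp
        induction hp using Nat.decreasingInduction with
        | self => exact h1
        | of_succ k hk hk' => exact fun h' => hk' (h2 k hk h')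
      have := split _ (hno 0 (Nat.zero_le _))
      simp only [zero_add] at this
      linarith

theorem le_four_mul_sum_of_le_two_mul_max {α : Type*} {ρ : α → α → ℝ} (h0 : ∀ x y, 0 ≤ ρ x y)
    (h : ∀ x y z, ρ x z ≤ 2 * max (ρ x y) (ρ y z)) {n : ℕ} (hn : 1 ≤ n) (c : ℕ → α) :
    ρ (c 0) (c n) ≤ 4 * ∑ i ∈ Finset.range n, ρ (c i) (c (i + 1)) := by
  obtain _ | _ | n := n
  · omega
  · have := h0 (c 0) (c 1)
    simp only [zero_add, Finset.sum_range_one]; linarith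
  · have := chain_le_of_le_two_mul_max h0 h n c
    have := h0 (c 0) (c 1)
    have := h0 (c (n + 1)) (c (n + 2))
    rw [add_assoc]; linarith

/-- This carries the chain inequality from the extremal visual parameter to the smaller ones. -/
theorem rpow_sum_le_sum_rpow {ι : Type*} (s : Finset ι) (f : ι → ℝ) (hf : ∀ i, 0 ≤ f i) {p : ℝ}
    (hp0 : 0 < p) (hp1 : p ≤ 1) : (∑ i ∈ s, f i) ^ p ≤ ∑ i ∈ s, f i ^ p := by
  classical
  induction s using Finset.induction_on with
  | empty => simp [Real.zero_rpow hp0.ne']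
  | insert a s ha ih =>
    rw [Finset.sum_insert ha, Finset.sum_insert ha]
    exact (Real.rpow_add_le_add_rpow (hf a) (Finset.sum_nonneg fun i _ => hf i) hp0.le hp1).trans
      (by linarith)

end Chain

end GromovHyp
namespace GromovHyp

/-! ### Gromov products of boundary points -/

section BoundaryProduct

variable {X : Type u} [MetricSpace X] {δ : ℝ} {hX : IsHyperbolic X δ} {o : X}

theorem IsHyperbolic.min_sub_le₄ (hX : IsHyperbolic X δ) (o x y z w : X) :
    min (gromovProduct o x y) (min (gromovProduct o y z) (gromovProduct o z w)) - 2 * δ ≤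
      gromovProduct o x w := by
  have h1 := hX o x y w
  have h2 := hX o y z w
  have hδ : 0 ≤ δ := by
    have := hX o o o o
    rw [min_self] at this; linarith
  have h3 : min (gromovProduct o x y) (min (gromovProduct o y z) (gromovProduct o z w)) - δ ≤
      min (gromovProduct o x y) (gromovProduct o y w) := by
    refine le_min ?_ ?_
    · have := min_le_left (gromovProduct o x y)
        (min (gromovProduct o y z) (gromovProduct o z w))
      linarith
    · have := min_le_right (gromovProduct o x y)
        (min (gromovProduct o y z) (gromovProduct o z w))
      linarith
  linarith

theorem IsCauchyGromov.eventually_le {x : ℕ → X} (h : IsCauchyGromov o x) (b : ℝ) :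
    ∃ N, ∀ m ≥ N, ∀ n ≥ N, b ≤ gromovProduct o (x m) (x n) := by
  have h1 := tendsto_atTop.1 h b
  rw [prod_atTop_atTop_eq] at h1
  obtain ⟨⟨N, M⟩, hN⟩ := eventually_atTop.1 h1
  exact ⟨max N M, fun m hm n hn => hN (m, n) ⟨le_of_max_le_left hm, le_of_max_le_right hn⟩⟩

theorem isCauchyGromov_iff {x : ℕ → X} : IsCauchyGromov o x ↔
    ∀ b : ℝ, ∃ N, ∀ m ≥ N, ∀ n ≥ N, b ≤ gromovProduct o (x m) (x n) := by
  refine ⟨fun h => h.eventually_le, fun h => tendsto_atTop.2 fun b => ?_⟩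
  obtain ⟨N, hN⟩ := h b
  rw [prod_atTop_atTop_eq]
  exact eventually_atTop.2 ⟨(N, N), fun p hp => hN _ hp.1 _ hp.2⟩

theorem exists_convergesTo (ξ : Boundary hX o) : ∃ x : ℕ → X, ConvergesTo x ξ := by
  induction ξ using Quotient.inductionOn with
  | _ x => exact ⟨x.1, x.2, rfl⟩

theorem ConvergesTo.tendsto {x y : ℕ → X} {ξ : Boundary hX o} (hx : ConvergesTo x ξ)
    (hy : ConvergesTo y ξ) : Tendsto (fun n => gromovProduct o (x n) (y n)) atTop atTop := by
  obtain ⟨_, hx⟩ := hx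
  obtain ⟨_, hy⟩ := hy
  exact Quotient.exact (s := boundarySetoid hX o) (hx.trans hy.symm)

theorem ConvergesTo.eq_of_tendsto {x y : ℕ → X} {ξ η : Boundary hX o} (hx : ConvergesTo x ξ)
    (hy : ConvergesTo y η) (h : Tendsto (fun n => gromovProduct o (x n) (y n)) atTop atTop) :
    ξ = η := by
  obtain ⟨_, rfl⟩ := hx
  obtain ⟨_, rfl⟩ := hy
  exact Quotient.sound (s := boundarySetoid hX o) h

theorem boundaryProduct_le_liminf {x y : ℕ → X} {ξ η : Boundary hX o}
    (hx : ConvergesTo x ξ) (hy : ConvergesTo y η) : boundaryProduct ξ η ≤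
      liminf (fun n : ℕ => ((gromovProduct o (x n) (y n) : ℝ) : EReal)) atTop :=
  iInf_le_of_le x <| iInf_le_of_le y <| iInf_le_of_le hx <| iInf_le_of_le hy le_rfl

theorem eventually_of_lt_boundaryProduct {x y : ℕ → X} {ξ η : Boundary hX o} {b : EReal}
    (hb : b < boundaryProduct ξ η) (hx : ConvergesTo x ξ) (hy : ConvergesTo y η) :
    ∀ᶠ n in atTop, b < (gromovProduct o (x n) (y n) : ℝ) :=
  eventually_lt_of_lt_liminf (hb.trans_le (boundaryProduct_le_liminf hx hy))

theorem le_boundaryProduct {ξ η : Boundary hX o} {b : EReal}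
    (h : ∀ x y : ℕ → X, ConvergesTo x ξ → ConvergesTo y η →
      ∀ᶠ n in atTop, b ≤ (gromovProduct o (x n) (y n) : ℝ)) : b ≤ boundaryProduct ξ η :=
  le_iInf₂ fun x y => le_iInf₂ fun hx hy => le_liminf_of_le (by isBoundedDefault) (h x y hx hy)

theorem boundaryProduct_self (ξ : Boundary hX o) : boundaryProduct ξ ξ = ⊤ := by
  rw [EReal.eq_top_iff_forall_lt]
  intro b
  refine (EReal.coe_lt_coe_iff.2 (lt_add_one b)).trans_le (le_boundaryProduct fun x y hx hy => ?_)
  filter_upwards [tendsto_atTop.1 (hx.tendsto hy) (b + 1)] with n hn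
  exact EReal.coe_le_coe_iff.2 hn

theorem boundaryProduct_ne_top {ξ η : Boundary hX o} (h : ξ ≠ η) : boundaryProduct ξ η ≠ ⊤ := by
  intro ht
  obtain ⟨x, hx⟩ := exists_convergesTo ξ
  obtain ⟨y, hy⟩ := exists_convergesTo η
  refine h (hx.eq_of_tendsto hy (tendsto_atTop.2 fun b => ?_))
  have := eventually_of_lt_boundaryProduct (b := (b : ℝ)) (ht ▸ EReal.coe_lt_top b) hx hy
  filter_upwards [this] with n hn
  exact (EReal.coe_lt_coe_iff.1 hn).le

theorem boundaryProduct_ne_bot (ξ η : Boundary hX o) : boundaryProduct ξ η ≠ ⊥ := by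
  have : ((0 : ℝ) : EReal) ≤ boundaryProduct ξ η := le_boundaryProduct fun x y _ _ =>
    Eventually.of_forall fun n => EReal.coe_le_coe_iff.2 (gromovProduct_nonneg _ _ _)
  exact fun h => by simp [h] at this

theorem coe_toReal_boundaryProduct {ξ η : Boundary hX o} (h : ξ ≠ η) :
    ((boundaryProduct ξ η).toReal : EReal) = boundaryProduct ξ η :=
  EReal.coe_toReal (boundaryProduct_ne_top h) (boundaryProduct_ne_bot _ _)

theorem eventually_lt_gromovProduct {x y : ℕ → X} {ξ η : Boundary hX o} (h : ξ ≠ η)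
    (hx : ConvergesTo x ξ) (hy : ConvergesTo y η) {b : ℝ}
    (hb : b < (boundaryProduct ξ η).toReal) :
    ∀ᶠ n in atTop, b < gromovProduct o (x n) (y n) := by
  have h' := coe_toReal_boundaryProduct h
  rw [← EReal.coe_lt_coe_iff, h'] at hb
  filter_upwards [eventually_of_lt_boundaryProduct hb hx hy] with n hn
  exact EReal.coe_lt_coe_iff.1 hn

/-- Some pair of sequences has product below `b` infinitely often. A late term of any other pair is
compared with it through the four points x'ₘ, xₙ, yₙ, y'ₘ, which costs 2δ. -/
theorem eventually_gromovProduct_lt {x y : ℕ → X} {ξ η : Boundary hX o} (h : ξ ≠ η)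
    (hx : ConvergesTo x ξ) (hy : ConvergesTo y η) {b : ℝ}
    (hb : (boundaryProduct ξ η).toReal < b) :
    ∀ᶠ n in atTop, gromovProduct o (x n) (y n) < b + 2 * δ := by
  have hb' : ∃ x' y' : ℕ → X, ConvergesTo x' ξ ∧ ConvergesTo y' η ∧
      ∃ᶠ n in atTop, gromovProduct o (x' n) (y' n) < b := by
    by_contra! hcon
    have : (b : EReal) ≤ boundaryProduct ξ η := le_boundaryProduct fun x y hx hy => by
      have := hcon x y hx hy
      filter_upwards [this] with n hn
      exact EReal.coe_le_coe_iff.2 hn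
    rw [← coe_toReal_boundaryProduct h, EReal.coe_le_coe_iff] at this
    linarith
  obtain ⟨x', y', hx', hy', hf⟩ := hb'
  -- The extra |δ| pays for passing from x'ₘ to xₙ through xₘ, and likewise for y.
  obtain ⟨N, hN⟩ := hx.1.eventually_le (b + 2 * δ + |δ|)
  obtain ⟨M, hM⟩ := hy.1.eventually_le (b + 2 * δ + |δ|)
  have ex := tendsto_atTop.1 (hx'.tendsto hx) (b + 2 * δ + |δ|)
  have ey := tendsto_atTop.1 (hy.tendsto hy') (b + 2 * δ + |δ|)
  obtain ⟨m, hm, hmx, hmy, hmN, hmM⟩ := (hf.and_eventually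
    (ex.and (ey.and ((eventually_ge_atTop N).and (eventually_ge_atTop M))))).exists
  have hδ := le_abs_self δ
  filter_upwards [eventually_ge_atTop N, eventually_ge_atTop M] with n hnN hnM
  by_contra! hcon
  have h1 := hX o (x' m) (x m) (x n)
  have h2 := hX o (y n) (y m) (y' m)
  have h1' := le_min hmx (hN m hmN n hnN)
  have h2' := le_min (hM n hnM m hmM) hmy
  have h3 := hX.min_sub_le₄ o (x' m) (x n) (y n) (y' m)
  have h3' : b + 2 * δ ≤ _ := le_min (by linarith : b + 2 * δ ≤ gromovProduct o (x' m) (x n))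
    (le_min hcon (by linarith : b + 2 * δ ≤ gromovProduct o (y n) (y' m)))
  linarith

/-- Because the boundary product is an infimum, one sequence for η serves both products on the left
and δ is not enlarged. The exact constant matters: it makes the kernel at the extremal parameter
satisfy Frink's condition with constant 2. -/
theorem min_sub_le_boundaryProduct_toReal {ξ η ζ : Boundary hX o} (h₁ : ξ ≠ η) (h₂ : η ≠ ζ)
    (h₃ : ξ ≠ ζ) : min (boundaryProduct ξ η).toReal (boundaryProduct η ζ).toReal - δ ≤
      (boundaryProduct ξ ζ).toReal := by
  refine le_of_forall_lt fun b hb => ?_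
  obtain ⟨b', hbb', hb'⟩ := exists_between hb
  refine hbb'.trans_le ?_
  rw [← EReal.coe_le_coe_iff, coe_toReal_boundaryProduct h₃]
  refine le_boundaryProduct fun x z hx hz => ?_
  obtain ⟨y, hy⟩ := exists_convergesTo η
  have hb1 : b' + δ < (boundaryProduct ξ η).toReal := by
    have := min_le_left (boundaryProduct ξ η).toReal (boundaryProduct η ζ).toReal; linarith
  have hb2 : b' + δ < (boundaryProduct η ζ).toReal := by
    have := min_le_right (boundaryProduct ξ η).toReal (boundaryProduct η ζ).toReal; linarith
  filter_upwards [eventually_lt_gromovProduct h₁ hx hy hb1,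
    eventually_lt_gromovProduct h₂ hy hz hb2] with n h1 h2
  have := hX o (x n) (y n) (z n)
  have := lt_min h1 h2
  rw [EReal.coe_le_coe_iff]
  linarith

end BoundaryProduct

/-! ### Visual distances and the cross-ratio -/

section VisualDist

variable {X : Type u} [MetricSpace X] {δ : ℝ} {hX : IsHyperbolic X δ} {o : X} {ν : ℝ}

theorem visualKernel_self (ξ : Boundary hX o) : visualKernel ν ξ ξ = 0 :=
  if_pos (boundaryProduct_self ξ)

theorem visualKernel_of_ne {ξ η : Boundary hX o} (h : ξ ≠ η) :
    visualKernel ν ξ η = ν ^ (-(boundaryProduct ξ η).toReal) :=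
  if_neg (boundaryProduct_ne_top h)

theorem visualKernel_nonneg (hν : 0 ≤ ν) (ξ η : Boundary hX o) : 0 ≤ visualKernel ν ξ η := by
  unfold visualKernel
  split_ifs
  · exact le_rfl
  · exact Real.rpow_nonneg hν _

theorem visualKernel_rpow (hν : 0 ≤ ν) {α : ℝ} (hα : 0 < α) (ξ η : Boundary hX o) :
    visualKernel (ν ^ α) ξ η = visualKernel ν ξ η ^ α := by
  rcases eq_or_ne ξ η with rfl | h
  · rw [visualKernel_self, visualKernel_self, Real.zero_rpow hα.ne']
  · rw [visualKernel_of_ne h, visualKernel_of_ne h, ← Real.rpow_mul hν, ← Real.rpow_mul hν,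
      mul_comm]

theorem visualKernel_le_max (hν : 1 < ν) {D : ℝ} (hD : δ ≤ D) (hD0 : 0 ≤ D)
    (ξ η ζ : Boundary hX o) :
    visualKernel ν ξ ζ ≤ ν ^ D * max (visualKernel ν ξ η) (visualKernel ν η ζ) := by
  have hν0 : 0 < ν := by linarith
  have h1 : 1 ≤ ν ^ D := Real.one_le_rpow hν.le hD0
  have hmax : max (visualKernel ν ξ η) (visualKernel ν η ζ) ≤
      ν ^ D * max (visualKernel ν ξ η) (visualKernel ν η ζ) :=
    le_mul_of_one_le_left (le_max_of_le_left (visualKernel_nonneg hν0.le _ _)) h1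
  rcases eq_or_ne ξ ζ with rfl | h₃
  · rw [visualKernel_self]
    exact (le_max_of_le_left (visualKernel_nonneg hν0.le _ _)).trans hmax
  rcases eq_or_ne ξ η with rfl | h₁
  · exact (le_max_right _ _).trans hmax
  rcases eq_or_ne η ζ with rfl | h₂
  · exact (le_max_left _ _).trans hmax
  have h := min_sub_le_boundaryProduct_toReal h₁ h₂ h₃
  rw [visualKernel_of_ne h₁, visualKernel_of_ne h₂, visualKernel_of_ne h₃]
  rcases min_le_iff.1 (sub_le_iff_le_add.1 h) with h | h
  · refine le_trans ?_ (mul_le_mul_of_nonneg_left (le_max_left _ _) (by linarith))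
    rw [← Real.rpow_add hν0]
    exact Real.rpow_le_rpow_of_exponent_le hν.le (by linarith)
  · refine le_trans ?_ (mul_le_mul_of_nonneg_left (le_max_right _ _) (by linarith))
    rw [← Real.rpow_add hν0]
    exact Real.rpow_le_rpow_of_exponent_le hν.le (by linarith)

/-- At μ = 2^(1/D) Frink's inequality applies with factor 4. Writing ν = μ^α with 0 < α ≤ 1 and
raising to the power α turns this factor into 4^α = ν^(2D), an error in the exponent independent of
ν. -/
theorem visualKernel_le_sum {D : ℝ} (hD : δ ≤ D) (hD0 : 0 < D) (hν : 1 < ν)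
    (hνD : ν ≤ 2 ^ (1 / D)) {n : ℕ} (hn : 1 ≤ n) (c : ℕ → Boundary hX o) :
    visualKernel ν (c 0) (c n) ≤
      ν ^ (2 * D) * ∑ i ∈ Finset.range n, visualKernel ν (c i) (c (i + 1)) := by
  set μ : ℝ := 2 ^ (1 / D) with hμ
  have hμ1 : 1 < μ := hν.trans_le hνD
  have hμ0 : 0 < μ := by linarith
  have hμD : μ ^ D = 2 := by
    rw [hμ, ← Real.rpow_mul (by norm_num), one_div_mul_cancel hD0.ne', Real.rpow_one]
  set α := Real.logb μ ν
  have hα : μ ^ α = ν := Real.rpow_logb hμ0 hμ1.ne' (by linarith)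
  have hα0 : 0 < α := Real.logb_pos hμ1 hν
  have hα1 : α ≤ 1 := by
    rw [Real.logb_le_iff_le_rpow hμ1 (by linarith), Real.rpow_one]; exact hνD
  have key := le_four_mul_sum_of_le_two_mul_max (visualKernel_nonneg (hX := hX) (o := o) hμ0.le)
    (fun ξ η ζ => hμD ▸ visualKernel_le_max hμ1 hD hD0.le ξ η ζ) hn c
  have h4 : ν ^ (2 * D) = 4 ^ α := by
    rw [← hα, ← Real.rpow_mul hμ0.le, mul_comm, Real.rpow_mul hμ0.le, mul_comm 2 D,
      Real.rpow_mul hμ0.le, hμD]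
    norm_num
  rw [h4, ← hα]
  simp only [visualKernel_rpow hμ0.le hα0]
  have hs := rpow_sum_le_sum_rpow (Finset.range n)
    (fun i => visualKernel μ (c i) (c (i + 1))) (fun i => visualKernel_nonneg hμ0.le _ _) hα0 hα1
  calc _ ≤ (4 * ∑ i ∈ Finset.range n, visualKernel μ (c i) (c (i + 1))) ^ α :=
        Real.rpow_le_rpow (visualKernel_nonneg hμ0.le _ _) key hα0.le
    _ = 4 ^ α * (∑ i ∈ Finset.range n, visualKernel μ (c i) (c (i + 1))) ^ α :=
        Real.mul_rpow (by norm_num) (Finset.sum_nonneg fun i _ => visualKernel_nonneg hμ0.le _ _)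
    _ ≤ _ := mul_le_mul_of_nonneg_left hs (by positivity)

theorem visualDist_le_visualKernel (hν : 0 ≤ ν) (ξ η : Boundary hX o) :
    visualDist ν ξ η ≤ visualKernel ν ξ η := by
  refine csInf_le ⟨0, ?_⟩ ⟨1, fun i => if i = 0 then ξ else η, le_rfl, by simp, by simp, by simp⟩
  rintro _ ⟨n, c, -, -, -, rfl⟩
  exact Finset.sum_nonneg fun i _ => visualKernel_nonneg hν _ _

theorem visualKernel_le_visualDist {D : ℝ} (hD : δ ≤ D) (hD0 : 0 < D) (hν : 1 < ν)
    (hνD : ν ≤ 2 ^ (1 / D)) (ξ η : Boundary hX o) :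
    ν ^ (-(2 * D)) * visualKernel ν ξ η ≤ visualDist ν ξ η := by
  have hν0 : 0 < ν := by linarith
  refine le_csInf ⟨_, 1, fun i => if i = 0 then ξ else η, le_rfl, by simp, by simp, rfl⟩ ?_
  rintro _ ⟨n, c, hn, rfl, rfl, rfl⟩
  rw [Real.rpow_neg hν0.le, inv_mul_le_iff₀ (by positivity)]
  exact visualKernel_le_sum hD hD0 hν hνD hn c

/-- On distinct boundary points, the visual distance is `ν ^ (-(ξ | η)_o)` up to a bounded
change of the exponent, uniformly in `ν`. -/
theorem visualDist_pos_and_logb_bounds {D : ℝ} (hD : δ ≤ D) (hD0 : 0 < D) (hν : 1 < ν)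
    (hνD : ν ≤ 2 ^ (1 / D)) {ξ η : Boundary hX o} (h : ξ ≠ η) :
    0 < visualDist ν ξ η ∧
      -(boundaryProduct ξ η).toReal - 2 * D ≤ Real.logb ν (visualDist ν ξ η) ∧
      Real.logb ν (visualDist ν ξ η) ≤ -(boundaryProduct ξ η).toReal := by
  have hν0 : 0 < ν := by linarith
  have h1 := visualDist_le_visualKernel hν0.le ξ η
  have h2 := visualKernel_le_visualDist hD hD0 hν hνD ξ η
  rw [visualKernel_of_ne h] at h1 h2
  rw [← Real.rpow_add hν0] at h2
  have hpos : 0 < visualDist ν ξ η := lt_of_lt_of_le (by positivity) h2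
  refine ⟨hpos, ?_, ?_⟩
  · rw [Real.le_logb_iff_rpow_le hν hpos]
    convert h2 using 2; ring
  · rwa [Real.logb_le_iff_le_rpow hν hpos]

theorem abs_logb_crossRatio_sub_le {D : ℝ} (hD : δ ≤ D) (hD0 : 0 < D) (hν : 1 < ν)
    (hνD : ν ≤ 2 ^ (1 / D)) {ξ₁ ξ₂ ξ₃ ξ₄ : Boundary hX o} (h₁₃ : ξ₁ ≠ ξ₃) (h₂₄ : ξ₂ ≠ ξ₄)
    (h₁₄ : ξ₁ ≠ ξ₄) (h₂₃ : ξ₂ ≠ ξ₃) :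
    |Real.logb ν (crossRatio ν ξ₁ ξ₂ ξ₃ ξ₄) -
      ((boundaryProduct ξ₁ ξ₄).toReal + (boundaryProduct ξ₂ ξ₃).toReal
        - (boundaryProduct ξ₁ ξ₃).toReal - (boundaryProduct ξ₂ ξ₄).toReal)| ≤ 4 * D := by
  obtain ⟨p13, l13, u13⟩ := visualDist_pos_and_logb_bounds hD hD0 hν hνD h₁₃
  obtain ⟨p24, l24, u24⟩ := visualDist_pos_and_logb_bounds hD hD0 hν hνD h₂₄
  obtain ⟨p14, l14, u14⟩ := visualDist_pos_and_logb_bounds hD hD0 hν hνD h₁₄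
  obtain ⟨p23, l23, u23⟩ := visualDist_pos_and_logb_bounds hD hD0 hν hνD h₂₃
  rw [crossRatio, Real.logb_div (by positivity) (by positivity),
    Real.logb_mul p13.ne' p24.ne', Real.logb_mul p14.ne' p23.ne', abs_le]
  -- Each logarithm has a one-sided error in [-2D, 0]: the numerator contributes down to -4D, the
  -- denominator up to 4D.
  constructor <;> linarith

end VisualDist

end GromovHyp
namespace GromovHyp

/-! ### Existence of geodesic lines -/

section Lines

variable {X : Type u} [MetricSpace X] {δ : ℝ} {hX : IsHyperbolic X δ} {o : X}

theorem isCauchyGromov_ray {r : ℝ → X}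
    (hr : ∀ s t, 0 ≤ s → 0 ≤ t → dist (r s) (r t) = |s - t|) :
    IsCauchyGromov o (fun n : ℕ => r n) := by
  rw [isCauchyGromov_iff]
  intro b
  obtain ⟨N, hN⟩ := exists_nat_ge (b + dist (r 0) o)
  refine ⟨N, fun m hm n hn => ?_⟩
  have hm' : (N : ℝ) ≤ m := Nat.cast_le.2 hm
  have hn' : (N : ℝ) ≤ n := Nat.cast_le.2 hn
  have t1 := dist_triangle_right (r m) (r 0) o
  have t2 := dist_triangle_right (r n) (r 0) o
  rw [hr _ _ (Nat.cast_nonneg _) le_rfl, sub_zero, Nat.abs_cast] at t1 t2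
  simp only [gromovProduct]
  rw [hr _ _ (Nat.cast_nonneg _) (Nat.cast_nonneg _)]
  rcases abs_cases ((m : ℝ) - n) with ⟨e, _⟩ | ⟨e, _⟩ <;> rw [e] <;> linarith

/-- If longer and longer geodesic segments start near `o`, end at `x m` and converge pointwise
to a ray, then the ray converges to the boundary point represented by `x`. -/
theorem convergesTo_of_tendsto_segments {U : Filter ℕ} [U.NeBot] (hU : U ≤ atTop) {x : ℕ → X}
    {ξ : Boundary hX o} (hx : ConvergesTo x ξ) {τ : ℕ → ℝ → X} {a : ℕ → ℝ}
    (ha : Tendsto a atTop atTop)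
    (hτ : ∀ m, ∀ s ∈ Set.Icc 0 (a m), ∀ t ∈ Set.Icc 0 (a m), dist (τ m s) (τ m t) = |s - t|)
    (hτx : ∀ m, τ m (a m) = x m) {R : ℝ} (hR : ∀ m, dist (τ m 0) o ≤ R) {r : ℝ → X}
    (hr : ∀ s t, 0 ≤ s → 0 ≤ t → dist (r s) (r t) = |s - t|)
    (hlim : ∀ t, 0 ≤ t → Tendsto (fun m => τ m t) U (𝓝 (r t))) :
    ConvergesTo (fun n : ℕ => r n) ξ := by
  have hcg : IsCauchyGromov o (fun n : ℕ => r n) := isCauchyGromov_ray hr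
  obtain ⟨hxc, rfl⟩ := hx
  refine ⟨hcg, Quotient.sound (s := boundarySetoid hX o) (tendsto_atTop.2 fun b => ?_)⟩
  obtain ⟨N, hN⟩ := hxc.eventually_le (b + |δ|)
  obtain ⟨M, hM⟩ := exists_nat_ge (b + 2 * |δ| + R + 1)
  have hδ := le_abs_self δ
  have hδ0 := abs_nonneg δ
  filter_upwards [eventually_ge_atTop N, eventually_ge_atTop M] with n hnN hnM
  have hnM' : (M : ℝ) ≤ n := Nat.cast_le.2 hnM
  have h1 : ∀ᶠ m in U, dist (τ m n) (r n) < 1 :=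
    (hlim n (Nat.cast_nonneg n)).eventually (Metric.ball_mem_nhds _ one_pos)
  obtain ⟨m, hm1, hma, hmN⟩ := (h1.and (((ha.eventually_ge_atTop (n : ℝ)).filter_mono hU).and
    ((eventually_ge_atTop N).filter_mono hU))).exists
  have hn0 : (0 : ℝ) ≤ n := Nat.cast_nonneg n
  have e1 := hτ m n ⟨hn0, hma⟩ (a m) ⟨hn0.trans hma, le_rfl⟩
  have e2 := hτ m n ⟨hn0, hma⟩ 0 ⟨le_rfl, hn0.trans hma⟩
  have e3 := hτ m (a m) ⟨hn0.trans hma, le_rfl⟩ 0 ⟨le_rfl, hn0.trans hma⟩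
  rw [abs_of_nonpos (by linarith)] at e1
  rw [sub_zero, abs_of_nonneg hn0] at e2
  rw [sub_zero, abs_of_nonneg (hn0.trans hma)] at e3
  rw [hτx] at e1 e3
  have t1 := dist_triangle_right (τ m n) (τ m 0) o
  have t2 := dist_triangle_right (x m) (τ m 0) o
  have t3 := dist_triangle_left (r n) (x m) (τ m n)
  have t4 := dist_triangle (τ m n) (r n) o
  have hRm := hR m
  -- The point `r n` is within 1 of a segment that runs from within `R` of `o` to `x m`, so the
  -- product is at least n - R - 1.
  have g1 : b + |δ| ≤ gromovProduct o (r n) (x m) := by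
    simp only [gromovProduct]; linarith
  have := hX o (r n) (x m) (x n)
  have := le_min g1 (hN m hmN n hnN)
  change b ≤ gromovProduct o (r n) (x n)
  linarith

theorem exists_ultrafilter_limit [ProperSpace X] (U : Ultrafilter ℕ) {σ : ℕ → X} {R : ℝ}
    (h : ∀ᶠ m in U, dist (σ m) o ≤ R) : ∃ y, Tendsto σ U (𝓝 y) := by
  obtain ⟨y, -, hy⟩ := (isCompact_closedBall o R).ultrafilter_le_nhds (U.map σ)
    (le_principal_iff.2 h)
  exact ⟨y, hy⟩

/-- A pointwise limit of geodesic segments that pass near `o` and whose ends converge to distinct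
boundary points is a geodesic line. -/
theorem exists_isLineBetween_of_segments [ProperSpace X] {x y : ℕ → X} {ξ η : Boundary hX o}
    (hx : ConvergesTo x ξ) (hy : ConvergesTo y η) {σ : ℕ → ℝ → X} {a b : ℕ → ℝ}
    (ha : Tendsto a atTop atTop) (hb : Tendsto b atTop atTop)
    (ha0 : ∀ m, 0 ≤ a m) (hb0 : ∀ m, 0 ≤ b m)
    (hσ : ∀ m, ∀ s ∈ Set.Icc (-a m) (b m), ∀ t ∈ Set.Icc (-a m) (b m),
      dist (σ m s) (σ m t) = |s - t|)
    (hσx : ∀ m, σ m (-a m) = x m) (hσy : ∀ m, σ m (b m) = y m)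
    {R : ℝ} (hR : ∀ m, dist (σ m 0) o ≤ R) :
    ∃ χ : ℝ → X, IsLineBetween χ ξ η := by
  -- A nonprincipal ultrafilter provides limits at all real times at once, in place of a diagonal
  -- extraction.
  let U : Ultrafilter ℕ := hyperfilter ℕ
  have hU : (U : Filter ℕ) ≤ atTop := Nat.hyperfilter_le_atTop
  have hmem : ∀ t : ℝ, ∀ᶠ m in (U : Filter ℕ), t ∈ Set.Icc (-a m) (b m) := fun t => by
    filter_upwards [hU (ha.eventually_ge_atTop (-t)), hU (hb.eventually_ge_atTop t)] with m h1 h2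
    exact ⟨by linarith, h2⟩
  have hlim : ∀ t : ℝ, ∃ p, Tendsto (fun m => σ m t) U (𝓝 p) := fun t => by
    refine exists_ultrafilter_limit (o := o) (R := |t| + R) U ?_
    filter_upwards [hmem t] with m hm
    have e := hσ m t hm 0 ⟨by linarith [ha0 m], hb0 m⟩
    rw [sub_zero] at e
    have := dist_triangle (σ m t) (σ m 0) o
    linarith [hR m]
  choose χ hχ using hlim
  have hiso : ∀ s t, dist (χ s) (χ t) = |s - t| := fun s t => by
    refine tendsto_nhds_unique ((hχ s).dist (hχ t)) (tendsto_const_nhds.congr' ?_)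
    filter_upwards [hmem s, hmem t] with m hs ht
    exact (hσ m s hs t ht).symm
  refine ⟨χ, Isometry.of_dist_eq fun s t => by rw [hiso, Real.dist_eq], ?_, ?_⟩
  · refine convergesTo_of_tendsto_segments (r := fun t => χ (-t)) (τ := fun m t => σ m (-t))
      (R := R) hU hx ha ?_ hσx (fun m => by simpa using hR m) ?_ fun t _ => hχ (-t)
    · intro m s hs t ht
      rw [hσ m (-s) ⟨by linarith [hs.2], by linarith [hs.1, hb0 m]⟩ (-t)
        ⟨by linarith [ht.2], by linarith [ht.1, hb0 m]⟩, neg_sub_neg, abs_sub_comm]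
    · intro s t _ _
      rw [hiso, neg_sub_neg, abs_sub_comm]
  · refine convergesTo_of_tendsto_segments hU hy hb ?_ hσy hR (fun s t _ _ => hiso s t)
      fun t _ => hχ t
    intro m s hs t ht
    exact hσ m s ⟨by linarith [hs.1, ha0 m], hs.2⟩ t ⟨by linarith [ht.1, ha0 m], ht.2⟩

theorem ConvergesTo.comp_add {x : ℕ → X} {ξ : Boundary hX o} (hx : ConvergesTo x ξ) (N : ℕ) :
    ConvergesTo (fun n => x (n + N)) ξ := by
  obtain ⟨h, rfl⟩ := hx
  have h' : IsCauchyGromov o (fun n => x (n + N)) := by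
    rw [isCauchyGromov_iff] at h ⊢
    intro b
    obtain ⟨M, hM⟩ := h b
    exact ⟨M, fun m hm n hn => hM _ (by omega) _ (by omega)⟩
  refine ⟨h', Quotient.sound (s := boundarySetoid hX o) (tendsto_atTop.2 fun b => ?_)⟩
  obtain ⟨M, hM⟩ := h.eventually_le b
  filter_upwards [eventually_ge_atTop M] with n hn
  exact hM _ (by omega) _ hn

theorem ConvergesTo.tendsto_dist {x : ℕ → X} {ξ : Boundary hX o} (hx : ConvergesTo x ξ) :
    Tendsto (fun n => dist (x n) o) atTop atTop :=
  tendsto_atTop_mono (fun _ => gromovProduct_le_dist_left _ _ _) (hx.tendsto hx)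

/-- In a proper geodesic hyperbolic space, distinct boundary points are joined by a geodesic
line. -/
theorem exists_isLineBetween [ProperSpace X] (hgeo : IsGeodesicSpace X) {ξ η : Boundary hX o}
    (h : ξ ≠ η) : ∃ χ : ℝ → X, IsLineBetween χ ξ η := by
  obtain ⟨x₀, hx₀⟩ := exists_convergesTo ξ
  obtain ⟨y₀, hy₀⟩ := exists_convergesTo η
  obtain ⟨N, hN⟩ := eventually_atTop.1 (eventually_gromovProduct_lt h hx₀ hy₀ (lt_add_one _))
  obtain ⟨x, hx, y, hy, R, hxy⟩ : ∃ x : ℕ → X, ConvergesTo x ξ ∧ ∃ y : ℕ → X, ConvergesTo y η ∧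
      ∃ R, ∀ n, gromovProduct o (x n) (y n) + 2 * δ ≤ R :=
    ⟨_, hx₀.comp_add N, _, hy₀.comp_add N, _, fun n =>
      add_le_add_left (hN (n + N) (Nat.le_add_left _ _)).le _⟩
  choose γ hγ0 hγ1 hγ using fun m => hgeo (x m) (y m)
  -- These points stay within `R` of `o`, since (xₘ|yₘ)ₒ is bounded; they become time 0 of the
  -- reparametrised segments.
  choose t ht hpx hpy using fun m => exists_internal_point dist_nonneg (hγ m) o
  have hp : ∀ m, dist (γ m (t m)) o ≤ R := fun m => by
    rw [dist_comm]
    refine (hX.dist_le_of_internal_point (hpx m) (hpy m)).trans ?_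
    rw [hγ0, hγ1]; exact hxy m
  have ex : ∀ m, dist (x m) (γ m (t m)) = t m := fun m => by
    rw [← hγ0 m, hγ m 0 ⟨le_rfl, dist_nonneg⟩ _ (ht m), zero_sub, abs_neg,
      abs_of_nonneg (ht m).1]
  have ey : ∀ m, dist (y m) (γ m (t m)) = dist (x m) (y m) - t m := fun m => by
    nth_rw 1 [← hγ1 m]
    rw [hγ m _ ⟨dist_nonneg, le_rfl⟩ _ (ht m), abs_of_nonneg (by linarith [(ht m).2])]
  refine exists_isLineBetween_of_segments hx hy (σ := fun m s => γ m (s + t m)) (a := t)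
    (b := fun m => dist (x m) (y m) - t m) (R := R) ?_ ?_ (fun m => (ht m).1)
    (fun m => sub_nonneg.2 (ht m).2) ?_ (fun m => by simp [hγ0]) (fun m => by simp [hγ1])
    (fun m => by simpa using hp m)
  · refine tendsto_atTop_mono (fun m => ?_) (tendsto_atTop_add_const_right _ (-R) hx.tendsto_dist)
    have := dist_triangle (x m) (γ m (t m)) o
    linarith [ex m, hp m]
  · refine tendsto_atTop_mono (fun m => ?_) (tendsto_atTop_add_const_right _ (-R) hy.tendsto_dist)
    have := dist_triangle (y m) (γ m (t m)) o
    linarith [ey m, hp m]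
  · intro m s hs u hu
    rw [hγ m _ ⟨by linarith [hs.1], by linarith [hs.2]⟩ _ ⟨by linarith [hu.1], by linarith [hu.2]⟩,
      add_sub_add_right_eq_sub]

end Lines

/-! ### Distance between lines and conclusion -/

section CrossRatio

variable {X : Type u} [MetricSpace X] {δ : ℝ} {hX : IsHyperbolic X δ} {o : X}

theorem setDist_le_dist {A B : Set X} {p q : X} (hp : p ∈ A) (hq : q ∈ B) :
    setDist A B ≤ dist p q :=
  ciInf_le (f := fun r : A × B => dist (r.1 : X) (r.2 : X))
    ⟨0, by rintro _ ⟨_, rfl⟩; exact dist_nonneg⟩ (⟨p, hp⟩, ⟨q, hq⟩)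

theorem le_setDist_range {χ σ : ℝ → X} {c : ℝ} (h : ∀ s t, c ≤ dist (χ s) (σ t)) :
    c ≤ setDist (Set.range χ) (Set.range σ) := by
  refine le_ciInf ?_
  rintro ⟨⟨_, s, rfl⟩, ⟨_, t, rfl⟩⟩
  exact h s t

theorem eventually_gromovProduct_bounds {x y : ℕ → X} {ξ η : Boundary hX o} (h : ξ ≠ η)
    (hx : ConvergesTo x ξ) (hy : ConvergesTo y η) : ∀ᶠ n in atTop,
      (boundaryProduct ξ η).toReal - 1 ≤ gromovProduct o (x n) (y n) ∧
      gromovProduct o (x n) (y n) ≤ (boundaryProduct ξ η).toReal + 1 + 2 * δ := by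
  filter_upwards [eventually_lt_gromovProduct h hx hy (sub_one_lt _),
    eventually_gromovProduct_lt h hx hy (lt_add_one _)] with n h1 h2
  exact ⟨h1.le, h2.le⟩

/-- The distance between two geodesic lines, in terms of the Gromov products of their
endpoints. -/
theorem setDist_range_bounds {ξ₁ ξ₂ ξ₃ ξ₄ : Boundary hX o}
    (h₁₃ : ξ₁ ≠ ξ₃) (h₂₄ : ξ₂ ≠ ξ₄) (h₁₄ : ξ₁ ≠ ξ₄) (h₂₃ : ξ₂ ≠ ξ₃) {χ σ : ℝ → X}
    (hχ : IsLineBetween χ ξ₁ ξ₄) (hσ : IsLineBetween σ ξ₂ ξ₃) :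
    setDist (Set.range χ) (Set.range σ) ≤ max 0 ((boundaryProduct ξ₁ ξ₄).toReal
        + (boundaryProduct ξ₂ ξ₃).toReal - (boundaryProduct ξ₁ ξ₃).toReal
        - (boundaryProduct ξ₂ ξ₄).toReal) + 9 * δ + 4 ∧
      (boundaryProduct ξ₁ ξ₄).toReal + (boundaryProduct ξ₂ ξ₃).toReal
        - (boundaryProduct ξ₁ ξ₃).toReal - (boundaryProduct ξ₂ ξ₄).toReal ≤
      setDist (Set.range χ) (Set.range σ) + 4 * δ + 4 := by
  obtain ⟨hχi, hχ₁, hχ₄⟩ := hχ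
  obtain ⟨hσi, hσ₂, hσ₃⟩ := hσ
  have hδ : 0 ≤ δ := by
    have := hX o o o o
    rw [min_self] at this; linarith
  have hev := (eventually_gromovProduct_bounds h₁₄ hχ₁ hχ₄).and
    ((eventually_gromovProduct_bounds h₂₃ hσ₂ hσ₃).and
    ((eventually_gromovProduct_bounds h₁₃ hχ₁ hσ₃).and
    (eventually_gromovProduct_bounds h₂₄ hσ₂ hχ₄)))
  -- In E, passing between finite and boundary products costs 4δ + 4: 1 for each of the four
  -- products and 2δ for each of two of them. The upper bound also has the 5δ from the segments.
  constructor
  · obtain ⟨n, ⟨l14, u14⟩, ⟨l23, u23⟩, ⟨l13, u13⟩, ⟨l24, u24⟩⟩ := hev.exists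
    have hn : -(n : ℝ) ≤ n := by linarith [(Nat.cast_nonneg n : (0 : ℝ) ≤ n)]
    obtain ⟨s, t, hst⟩ := hX.exists_dist_geodesics_le hn hn
      (fun s _ t _ => (hχi.dist_eq s t).trans (Real.dist_eq s t))
      (fun s _ t _ => (hσi.dist_eq s t).trans (Real.dist_eq s t)) o
    have h1 := (setDist_le_dist (Set.mem_range_self s) (Set.mem_range_self t)).trans hst
    refine h1.trans ?_
    rcases max_cases (0 : ℝ) (gromovProduct o (χ (-n)) (χ n) + gromovProduct o (σ (-n)) (σ n)
      - gromovProduct o (χ (-n)) (σ n) - gromovProduct o (σ (-n)) (χ n)) with ⟨e, _⟩ | ⟨e, _⟩ <;>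
      rw [e]
    · have := le_max_left 0 ((boundaryProduct ξ₁ ξ₄).toReal
        + (boundaryProduct ξ₂ ξ₃).toReal - (boundaryProduct ξ₁ ξ₃).toReal
        - (boundaryProduct ξ₂ ξ₄).toReal)
      linarith
    · have := le_max_right 0 ((boundaryProduct ξ₁ ξ₄).toReal
        + (boundaryProduct ξ₂ ξ₃).toReal - (boundaryProduct ξ₁ ξ₃).toReal
        - (boundaryProduct ξ₂ ξ₄).toReal)
      linarith
  · rw [add_assoc, ← sub_le_iff_le_add]
    refine le_setDist_range fun s t => ?_
    obtain ⟨N, hN⟩ := exists_nat_ge (max |s| |t|)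
    obtain ⟨n, ⟨⟨l14, u14⟩, ⟨l23, u23⟩, ⟨l13, u13⟩, ⟨l24, u24⟩⟩, hn⟩ :=
      (hev.and (eventually_ge_atTop N)).exists
    have hn' : max |s| |t| ≤ (n : ℝ) := hN.trans (Nat.cast_le.2 hn)
    have := gromovProduct_sub_le_dist hχi hσi (le_of_max_le_left hn') (le_of_max_le_right hn') o
    linarith

end CrossRatio

/-- Replacing δ by D treats δ = 0 together with δ > 0: e = 2^(1/log 2). -/
theorem exists_visualParam_eq {δ : ℝ} : ∃ D : ℝ, δ ≤ D ∧ 0 < D ∧ visualParam δ = 2 ^ (1 / D) := by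
  by_cases h : 0 < δ
  · exact ⟨δ, le_rfl, h, if_pos h⟩
  · have hl := Real.log_pos one_lt_two
    refine ⟨Real.log 2, by linarith, hl, ?_⟩
    rw [visualParam, if_neg h, Real.rpow_def_of_pos two_pos, mul_one_div_cancel hl.ne']

end GromovHyp

theorem mainTheorem8 (δ : ℝ) (hδ : 0 ≤ δ) :
    ∃ C : ℝ, 0 ≤ C ∧
      ∀ (X : Type u) [MetricSpace X] [ProperSpace X] (_hgeo : GromovHyp.IsGeodesicSpace X)
        (hX : GromovHyp.IsHyperbolic X δ) (o : X) (ν : ℝ) (_hν : 1 < ν)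
        (_hνμ : ν ≤ GromovHyp.visualParam δ)
        (ξ₁ ξ₂ ξ₃ ξ₄ : GromovHyp.Boundary hX o)
        (_h₁₂ : ξ₁ ≠ ξ₂) (_h₁₃ : ξ₁ ≠ ξ₃) (_h₁₄ : ξ₁ ≠ ξ₄)
        (_h₂₃ : ξ₂ ≠ ξ₃) (_h₂₄ : ξ₂ ≠ ξ₄) (_h₃₄ : ξ₃ ≠ ξ₄),
        (∃ χ₁₄ : ℝ → X, GromovHyp.IsLineBetween χ₁₄ ξ₁ ξ₄) ∧
        (∃ χ₂₃ : ℝ → X, GromovHyp.IsLineBetween χ₂₃ ξ₂ ξ₃) ∧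
        ∀ χ₁₄ χ₂₃ : ℝ → X,
          GromovHyp.IsLineBetween χ₁₄ ξ₁ ξ₄ → GromovHyp.IsLineBetween χ₂₃ ξ₂ ξ₃ →
          GromovHyp.setDist (Set.range χ₁₄) (Set.range χ₂₃) - C
              ≤ GromovHyp.posLogb ν (GromovHyp.crossRatio ν ξ₁ ξ₂ ξ₃ ξ₄) ∧
            GromovHyp.posLogb ν (GromovHyp.crossRatio ν ξ₁ ξ₂ ξ₃ ξ₄)
              ≤ GromovHyp.setDist (Set.range χ₁₄) (Set.range χ₂₃) + C := by
  obtain ⟨D, hδD, hD0, hDμ⟩ := GromovHyp.exists_visualParam_eq (δ := δ)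
  refine ⟨4 * D + 9 * δ + 4, by linarith, ?_⟩
  intro X _ _ hgeo hX o ν hν hνμ ξ₁ ξ₂ ξ₃ ξ₄ _ h₁₃ h₁₄ h₂₃ h₂₄ _
  refine ⟨GromovHyp.exists_isLineBetween hgeo h₁₄, GromovHyp.exists_isLineBetween hgeo h₂₃, ?_⟩
  intro χ₁₄ χ₂₃ hχ₁₄ hχ₂₃
  obtain ⟨hu, hl⟩ := GromovHyp.setDist_range_bounds h₁₃ h₂₄ h₁₄ h₂₃ hχ₁₄ hχ₂₃
  obtain ⟨c1, c2⟩ := abs_le.1 (GromovHyp.abs_logb_crossRatio_sub_le hδD hD0 hν (hDμ ▸ hνμ)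
    h₁₃ h₂₄ h₁₄ h₂₃)
  have hd : 0 ≤ GromovHyp.setDist (Set.range χ₁₄) (Set.range χ₂₃) :=
    GromovHyp.le_setDist_range fun _ _ => dist_nonneg
  unfold GromovHyp.posLogb
  constructor
  · have m0 := le_max_left 0 (Real.logb ν (GromovHyp.crossRatio ν ξ₁ ξ₂ ξ₃ ξ₄))
    have m1 := le_max_right 0 (Real.logb ν (GromovHyp.crossRatio ν ξ₁ ξ₂ ξ₃ ξ₄))
    have := max_le (c := max 0 (Real.logb ν (GromovHyp.crossRatio ν ξ₁ ξ₂ ξ₃ ξ₄)) + 4 * D)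
      (by linarith : (0 : ℝ) ≤ _) (by linarith : (GromovHyp.boundaryProduct ξ₁ ξ₄).toReal
        + (GromovHyp.boundaryProduct ξ₂ ξ₃).toReal - (GromovHyp.boundaryProduct ξ₁ ξ₃).toReal
        - (GromovHyp.boundaryProduct ξ₂ ξ₄).toReal ≤ _)
    linarith
  · exact max_le (by linarith) (by linarith)
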